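/- Let $1\le m$, let $0=s[0]<s[1]<\dots<s[m]=n$ be integers, let $a_1,\dots,a_{m-1}$, $d_1,\dots,d_n$ and $B$ be positive integers, and let $f_i:[0,d_i]\to\mathbb R$ ($1\le i\le n$) be convex. Put $\bar a_0=0$, $\bar a_m=B$ and $\bar a_i=\min\{\bar a_{i-1}+\sum_{k=s[i-1]+1}^{s[i]}d_k,\;a_i\}$ for $1\le i\le m-1$. For $v\le w$ let $\mathrm{Nested}(v,w)$ be the problem in the variables $x_{s[v-1]+1},\dots,x_{s[w]}$ $$\min\sum_{i=s[v-1]+1}^{s[w]}f_i(x_i)\quad\text{s.t.}\quad\sum_{k=s[v-1]+1}^{s[i]}x_k\le\bar a_i-\bar a_{v-1}\ (v\le i\le w-1),\quad\sum_{k=s[v-1]+1}^{s[w]}x_k=\bar a_w-\bar a_{v-1},\quad 0\le x_i\le d_i,$$ and let $\mathrm{Rap}(v,w)$ with bounds $\hat c,\hat d$ be the problem with the same variables and objective, subject only to $\sum_{k=s[v-1]+1}^{s[w]}x_k=\bar a_w-\bar a_{v-1}$ and $\hat c_i\le x_i\le\hat d_i$. In all these problems the variables are either all required to be integers or all allowed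 to be real (continuous variables). Let $1\le v\le t\le w\le m$ with $v<w$, and let $(x^{\downarrow*}_i)_{s[v-1]<i\le s[t]}$ and $(x^{\uparrow*}_i)_{s[t]<i\le s[w]}$ be optimal solutions of $\mathrm{Nested}(v,t)$ and of $\mathrm{Nested}(t+1,w)$, respectively (for $t=w$ the latter problem has no variables). Put $\hat c_i=0$, $\hat d_i=x^{\downarrow*}_i$ for $s[v-1]<i\le s[t]$, and $\hat c_i=x^{\uparrow*}_i$, $\hat d_i=d_i$ for $s[t]<i\le s[w]$. Then $\mathrm{Rap}(v,w)$ with these bounds has an optimal solution, and every optimal solution of it is an optimal solution of $\mathrm{Nested}(v,w)$. This holds both for integer and for continuous variables; for continuous variables, the existence of an optimal solution of $\mathrm{Rap}(v,w)$ is claimed when every $f_i$ with $s[v-1]<i\le s[w]$ is lower semicontinuous (for a convex function on $[0,d_i]$, equivalently, continuous) on $[0,d_i]$, while the second assertion needs no such assumption. -/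

import Mathlib

open Finset

/-- The data, with the standing assumptions, of a separable convex resource allocation problem
with nested constraints
`min ∑ i ∈ {1,…,n}, f i (x i)` subject to `∑ k ∈ {1,…,s i}, x k ≤ a i` for `1 ≤ i ≤ m - 1`,
`∑ i ∈ {1,…,n}, x i = B` and `0 ≤ x i ≤ d i`.
Indices are 1-based: only `s 0, …, s m`, `a 1, …, a (m - 1)`, `d 1, …, d n`, and the values of
`f i` on `[0, d i]` for `1 ≤ i ≤ n`, have a meaning. -/
structure NestedProblem where
  /-- number of variables -/
  n : ℕ
  /-- number of blocks -/
  m : ℕ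
  one_le_m : 1 ≤ m
  /-- the increasing sequence of the last indices of the blocks -/
  s : ℕ → ℕ
  s_zero : s 0 = 0
  s_lt : ∀ i, i < m → s i < s (i + 1)
  s_last : s m = n
  /-- right-hand sides of the nested constraints -/
  a : ℕ → ℕ
  a_pos : ∀ i, 1 ≤ i → i < m → 0 < a i
  /-- upper bounds of the variables -/
  d : ℕ → ℕ
  d_pos : ∀ i, 1 ≤ i → i ≤ n → 0 < d i
  /-- total amount of resource -/
  B : ℕ
  B_pos : 0 < B
  /-- cost functions -/
  f : ℕ → ℝ → ℝ
  f_convex : ∀ i, 1 ≤ i → i ≤ n → ConvexOn ℝ (Set.Icc 0 (d i : ℝ)) (f i)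

namespace NestedProblem

/-- The tightened right-hand sides: `abar 0 = 0`, `abar m = B`, and
`abar i = min (abar (i - 1) + ∑ k ∈ {s (i - 1) + 1, …, s i}, d k) (a i)` for `1 ≤ i ≤ m - 1`
(the value for `i > m` is irrelevant). -/
def abar (P : NestedProblem) : ℕ → ℕ
  | 0 => 0
  | i + 1 =>
    if i + 1 < P.m then min (P.abar i + ∑ k ∈ Ioc (P.s i) (P.s (i + 1)), P.d k) (P.a (i + 1))
    else P.B

/-- The indices `s (v - 1) + 1, …, s w` of the variables of the subproblems of range `(v, w)`. -/
def block (P : NestedProblem) (v w : ℕ) : Finset ℕ := Ioc (P.s (v - 1)) (P.s w)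

/-- The objective `∑ i ∈ {s (v - 1) + 1, …, s w}, f i (x i)`. -/
def cost (P : NestedProblem) (v w : ℕ) (x : ℕ → ℝ) : ℝ := ∑ i ∈ P.block v w, P.f i (x i)

/-- Feasible solutions of `Nested(v, w)` with variables in `D` (`D` is the set of integers for
integer variables, and all of `ℝ` for continuous variables). A solution is a vector indexed by
`block v w`; it is represented by a function on `ℕ` whose values at other indices are ignored. -/
def nestedFeasible (P : NestedProblem) (D : Set ℝ) (v w : ℕ) : Set (ℕ → ℝ) :=
  {x | (∀ i ∈ Ico v w,
          ∑ k ∈ Ioc (P.s (v - 1)) (P.s i), x k ≤ (P.abar i : ℝ) - (P.abar (v - 1) : ℝ)) ∧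
       ∑ i ∈ P.block v w, x i = (P.abar w : ℝ) - (P.abar (v - 1) : ℝ) ∧
       ∀ i ∈ P.block v w, x i ∈ D ∧ 0 ≤ x i ∧ x i ≤ (P.d i : ℝ)}

/-- Feasible solutions of the plain problem `Rap(v, w)` with variable bounds `c ≤ x ≤ u`. -/
def rapFeasible (P : NestedProblem) (D : Set ℝ) (v w : ℕ) (c u : ℕ → ℝ) : Set (ℕ → ℝ) :=
  {x | ∑ i ∈ P.block v w, x i = (P.abar w : ℝ) - (P.abar (v - 1) : ℝ) ∧
       ∀ i ∈ P.block v w, x i ∈ D ∧ c i ≤ x i ∧ x i ≤ u i}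

/-- `x` is an optimal solution of `Nested(v, w)`. -/
def IsNestedOptimal (P : NestedProblem) (D : Set ℝ) (v w : ℕ) (x : ℕ → ℝ) : Prop :=
  x ∈ P.nestedFeasible D v w ∧ ∀ z ∈ P.nestedFeasible D v w, P.cost v w x ≤ P.cost v w z

/-- `x` is an optimal solution of `Rap(v, w)` with variable bounds `c` and `u`. -/
def IsRapOptimal (P : NestedProblem) (D : Set ℝ) (v w : ℕ) (c u : ℕ → ℝ) (x : ℕ → ℝ) : Prop :=
  x ∈ P.rapFeasible D v w c u ∧ ∀ z ∈ P.rapFeasible D v w c u, P.cost v w x ≤ P.cost v w z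

/-- The lower bounds: `0` on the left block (`i ≤ s t`), and `xup i` on the right one. -/
noncomputable def cHat (P : NestedProblem) (t : ℕ) (xup : ℕ → ℝ) (i : ℕ) : ℝ :=
  if i ≤ P.s t then 0 else xup i

/-- The upper bounds: `xdown i` on the left block (`i ≤ s t`), and `d i` on the right one. -/
noncomputable def dHat (P : NestedProblem) (t : ℕ) (xdown : ℕ → ℝ) (i : ℕ) : ℝ :=
  if i ≤ P.s t then xdown i else (P.d i : ℝ)

end NestedProblem

/-!
Every feasible solution of `Rap(v, w)` with the bounds `cHat`, `dHat` is feasible for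
`Nested(v, w)`: up to block `t` its prefix sums are dominated by those of `xdown`, and after it its
suffix sums dominate those of `xup` (`mem_nestedFeasible_of_mem_rapFeasible`). So it suffices to
show that every feasible `z` of `Nested(v, w)` is matched, at no larger cost, by some feasible `y`
of `Rap(v, w)`. The two ranges are treated separately, keeping the sum of `z` on each.

On the left range, the sum of `z` is at most that of `xdown`. Lower `z` to `xdown` wherever it
exceeds `xdown`, and distribute the removed amount over the indices with `z k < xdown k`, the
smallest indices first (`exists_greedy`). The result `y` lies below `xdown`, and applying the
opposite change to `xdown` gives `xdown + z - y`, each of whose prefix sums is at most that of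
`xdown` or that of `z` (`exists_exchange_le`); hence it is feasible, and not cheaper than `xdown`.
Since `y k` lies between `z k` and `xdown k`, convexity gives
`f (y k) + f (xdown k + z k - y k) ≤ f (xdown k) + f (z k)`, and so `y` costs at most as much
as `z`. On the right range, the same exchange is applied to `-z` and `-xup` with the order of the
indices reversed (`exists_exchange_ge`). The exchange only adds, subtracts and compares, so it stays
inside any additive subgroup `G` of `ℝ`; `G = ℤ` and `G = ℝ` are the two cases of the theorem.

Optimal solutions of `Rap(v, w)` exist because the feasible set is nonempty (glue `xdown` and `xup`)
and, up to irrelevant coordinates, compact.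
-/

/-! ### The exchange -/

theorem AddSubgroup.min_mem {G : AddSubgroup ℝ} {x y : ℝ} (hx : x ∈ G) (hy : y ∈ G) :
    min x y ∈ G := by
  rcases min_choice x y with h | h <;> rw [h] <;> assumption

/-- An amount `E` can be distributed over places of capacities `u k` greedily in the order of
increasing rank `r k`, so that the places of rank at most `c` receive as much as possible. -/
theorem exists_greedy (G : AddSubgroup ℝ) (r : ℕ → ℤ) (u : ℕ → ℝ) (J : Finset ℕ)
    (hu : ∀ k ∈ J, u k ∈ G ∧ 0 ≤ u k) (E : ℝ) (hEG : E ∈ G) (hE0 : 0 ≤ E)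
    (hE : E ≤ ∑ k ∈ J, u k) :
    ∃ δ : ℕ → ℝ, (∀ k ∈ J, δ k ∈ G ∧ 0 ≤ δ k ∧ δ k ≤ u k) ∧ ∑ k ∈ J, δ k = E ∧
      ∀ c : ℤ, ∑ k ∈ J with r k ≤ c, δ k = min (∑ k ∈ J with r k ≤ c, u k) E := by
  induction J using Finset.induction_on_max_value r generalizing E with
  | empty =>
    have : E = 0 := le_antisymm (by simpa using hE) hE0
    exact ⟨0, by simp, by simp [this], by simp [this]⟩
  | insert a J ha hmax ih =>
    have huJ : ∀ k ∈ J, u k ∈ G ∧ 0 ≤ u k := fun k hk => hu k (mem_insert_of_mem hk)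
    have hua := hu a (mem_insert_self a J)
    have hU : ∑ k ∈ J, u k ∈ G := G.sum_mem fun k hk => (huJ k hk).1
    have hU0 : 0 ≤ ∑ k ∈ J, u k := sum_nonneg fun k hk => (huJ k hk).2
    rw [sum_insert ha] at hE
    -- The places of smaller rank are served first, and `a` receives the rest.
    obtain ⟨δ, h1, h2, h3⟩ := ih huJ (min (∑ k ∈ J, u k) E) (AddSubgroup.min_mem hU hEG)
      (le_min hU0 hE0) (min_le_left _ _)
    have hne : ∀ k ∈ J, k ≠ a := fun k hk h => ha (h ▸ hk)
    have hall : ∑ k ∈ insert a J,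
        Function.update δ a (E - min (∑ k ∈ J, u k) E) k = E := by
      rw [sum_insert ha, Function.update_self,
        sum_congr rfl fun k hk => Function.update_of_ne (hne k hk) _ δ, h2]
      ring
    refine ⟨Function.update δ a (E - min (∑ k ∈ J, u k) E), ?_, hall, ?_⟩
    · intro k hk
      rcases mem_insert.1 hk with rfl | hk
      · rw [Function.update_self]
        refine ⟨G.sub_mem hEG (AddSubgroup.min_mem hU hEG), sub_nonneg.2 (min_le_right _ _), ?_⟩
        rcases min_choice (∑ k ∈ J, u k) E with h | h <;> rw [h] <;> linarith
      · rw [Function.update_of_ne (hne k hk)]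
        exact h1 k hk
    · intro c
      by_cases hc : r a ≤ c
      · have hf : (insert a J).filter (fun k => r k ≤ c) = insert a J := by
          refine filter_true_of_mem fun k hk => ?_
          rcases mem_insert.1 hk with rfl | hk
          · exact hc
          · exact (hmax k hk).trans hc
        rw [hf, hall, sum_insert ha, min_eq_right hE]
      · rw [filter_insert, if_neg hc,
          sum_congr rfl fun k hk => Function.update_of_ne (hne k (mem_filter.1 hk).1) _ δ, h3,
          ← min_assoc, min_eq_left (sum_le_sum_of_subset_of_nonneg (filter_subset _ _)
            fun k hk _ => (huJ k hk).2)]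

/-- If `z` has at most the sum of `x`, some `y ≤ x` between `z` and `x` has the sum of `z`, and the
opposite change of `x`, which is `x + z - y`, has no partial sum (with respect to the rank `r`)
exceeding both that of `x` and that of `z`. -/
theorem exists_exchange_le (G : AddSubgroup ℝ) (r : ℕ → ℤ) (J : Finset ℕ) (x z : ℕ → ℝ)
    (hx : ∀ k ∈ J, x k ∈ G) (hz : ∀ k ∈ J, z k ∈ G) (hzx : ∑ k ∈ J, z k ≤ ∑ k ∈ J, x k) :
    ∃ y : ℕ → ℝ, (∀ k ∈ J, y k ∈ G ∧ min (x k) (z k) ≤ y k ∧ y k ≤ x k) ∧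
      ∑ k ∈ J, y k = ∑ k ∈ J, z k ∧
      ∀ c : ℤ, ∑ k ∈ J with r k ≤ c, (x k + z k - y k) ≤
        max (∑ k ∈ J with r k ≤ c, x k) (∑ k ∈ J with r k ≤ c, z k) := by
  have hmG : ∀ k ∈ J, min (x k) (z k) ∈ G := fun k hk => AddSubgroup.min_mem (hx k hk) (hz k hk)
  obtain ⟨δ, h1, h2, h3⟩ := exists_greedy G r (fun k => x k - min (x k) (z k)) J
    (fun k hk => ⟨G.sub_mem (hx k hk) (hmG k hk), sub_nonneg.2 (min_le_left _ _)⟩)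
    (∑ k ∈ J, (z k - min (x k) (z k)))
    (G.sum_mem fun k hk => G.sub_mem (hz k hk) (hmG k hk))
    (sum_nonneg fun k _ => sub_nonneg.2 (min_le_right _ _))
    (by rw [sum_sub_distrib, sum_sub_distrib]; linarith)
  refine ⟨fun k => min (x k) (z k) + δ k, fun k hk => ?_, ?_, fun c => ?_⟩
  · obtain ⟨a, b, c⟩ := h1 k hk
    exact ⟨G.add_mem (hmG k hk) a, by linarith, by linarith⟩
  · rw [sum_add_distrib, h2, sum_sub_distrib]
    ring
  · have hex : ∑ k ∈ J with r k ≤ c, (z k - min (x k) (z k)) ≤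
        ∑ k ∈ J, (z k - min (x k) (z k)) :=
      sum_le_sum_of_subset_of_nonneg (filter_subset _ _)
        fun k _ _ => sub_nonneg.2 (min_le_right _ _)
    have h3c := h3 c
    rw [sum_sub_distrib] at h3c hex
    rw [sum_sub_distrib, sum_add_distrib, sum_add_distrib, h3c]
    -- Either the greedy distribution is complete at `c`, or all capacities up to `c` are used up.
    rcases min_choice (∑ k ∈ J with r k ≤ c, x k - ∑ k ∈ J with r k ≤ c, min (x k) (z k))
      (∑ k ∈ J, (z k - min (x k) (z k))) with h | h <;> rw [h]
    · exact le_max_of_le_right (by linarith)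
    · exact le_max_of_le_left (by linarith)

/-- The counterpart of `exists_exchange_le` for `z` with at least the sum of `x`. -/
theorem exists_exchange_ge (G : AddSubgroup ℝ) (r : ℕ → ℤ) (J : Finset ℕ) (x z : ℕ → ℝ)
    (hx : ∀ k ∈ J, x k ∈ G) (hz : ∀ k ∈ J, z k ∈ G) (hxz : ∑ k ∈ J, x k ≤ ∑ k ∈ J, z k) :
    ∃ y : ℕ → ℝ, (∀ k ∈ J, y k ∈ G ∧ x k ≤ y k ∧ y k ≤ max (x k) (z k)) ∧
      ∑ k ∈ J, y k = ∑ k ∈ J, z k ∧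
      ∀ c : ℤ, min (∑ k ∈ J with r k ≤ c, x k) (∑ k ∈ J with r k ≤ c, z k) ≤
        ∑ k ∈ J with r k ≤ c, (x k + z k - y k) := by
  obtain ⟨y, h1, h2, h3⟩ := exists_exchange_le G r J (fun k => -x k) (fun k => -z k)
    (fun k hk => G.neg_mem (hx k hk)) (fun k hk => G.neg_mem (hz k hk))
    (by simpa only [sum_neg_distrib, neg_le_neg_iff] using hxz)
  refine ⟨fun k => -y k, fun k hk => ?_, ?_, fun c => ?_⟩
  · obtain ⟨a, b, c⟩ := h1 k hk
    rw [min_neg_neg] at b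
    exact ⟨G.neg_mem a, by linarith, by linarith⟩
  · rw [sum_neg_distrib, h2, sum_neg_distrib, neg_neg]
  · have := h3 c
    simp only [sum_sub_distrib, sum_add_distrib, sum_neg_distrib, max_neg_neg] at this ⊢
    linarith

/-- Moving two points towards each other by the same amount does not increase the sum of the values
of a convex function at them. -/
theorem ConvexOn.add_le_add_of_min_le_of_le_max {s : Set ℝ} {f : ℝ → ℝ} (hf : ConvexOn ℝ s f)
    {x z y : ℝ} (hx : x ∈ s) (hz : z ∈ s) (h1 : min x z ≤ y) (h2 : y ≤ max x z) :
    f y + f (x + z - y) ≤ f x + f z := by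
  have hy : y ∈ segment ℝ x z := by
    rw [segment_eq_uIcc]
    exact ⟨h1, h2⟩
  obtain ⟨a, b, ha, hb, hab, rfl⟩ := hy
  have e : x + z - (a • x + b • z) = b • x + a • z := by
    simp only [smul_eq_mul]
    linear_combination (-x - z) * hab
  have h3 := hf.2 hx hz ha hb hab
  have h4 := hf.2 hx hz hb ha (by linarith)
  rw [e]
  simp only [smul_eq_mul] at h3 h4 ⊢
  linear_combination h3 + h4 + (f x + f z) * hab

namespace NestedProblem

variable {P : NestedProblem}

/-! ### Blocks of indices -/

theorem s_le_s {i j : ℕ} (hij : i ≤ j) (hj : j ≤ P.m) : P.s i ≤ P.s j := by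
  induction j, hij using Nat.le_induction with
  | base => exact le_rfl
  | succ j _ ih => exact (ih (by omega)).trans (P.s_lt j (by omega)).le

theorem convexOn_of_mem_block {v w k : ℕ} (hw : w ≤ P.m) (hk : k ∈ P.block v w) :
    ConvexOn ℝ (Set.Icc 0 (P.d k : ℝ)) (P.f k) := by
  obtain ⟨h1, h2⟩ := mem_Ioc.1 hk
  refine P.f_convex k (by omega) ?_
  rw [← P.s_last]
  exact h2.trans (s_le_s hw le_rfl)

theorem sum_block_add_sum_block {v t w : ℕ} (hvt : v ≤ t) (htw : t ≤ w) (hw : w ≤ P.m)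
    (g : ℕ → ℝ) :
    ∑ k ∈ P.block v t, g k + ∑ k ∈ P.block (t + 1) w, g k = ∑ k ∈ P.block v w, g k :=
  sum_Ioc_consecutive g (s_le_s (by omega) (by omega)) (s_le_s htw hw)

theorem block_left_subset {v t w : ℕ} (htw : t ≤ w) (hw : w ≤ P.m) :
    P.block v t ⊆ P.block v w := Ioc_subset_Ioc_right (s_le_s htw hw)

theorem block_right_subset {v t w : ℕ} (hvt : v ≤ t) (htw : t ≤ w) (hw : w ≤ P.m) :
    P.block (t + 1) w ⊆ P.block v w := Ioc_subset_Ioc_left (s_le_s (by omega) (by omega))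

theorem mem_block_cases {v t w k : ℕ} (hk : k ∈ P.block v w) :
    (k ∈ P.block v t ∧ k ≤ P.s t) ∨ (k ∈ P.block (t + 1) w ∧ ¬ k ≤ P.s t) := by
  obtain ⟨h1, h2⟩ := mem_Ioc.1 hk
  by_cases h : k ≤ P.s t
  · exact Or.inl ⟨mem_Ioc.2 ⟨h1, h⟩, h⟩
  · exact Or.inr ⟨mem_Ioc.2 ⟨not_le.1 h, h2⟩, h⟩

theorem le_s_of_mem_block {v t k : ℕ} (hk : k ∈ P.block v t) : k ≤ P.s t := (mem_Ioc.1 hk).2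

theorem not_le_s_of_mem_block {t w k : ℕ} (hk : k ∈ P.block (t + 1) w) : ¬ k ≤ P.s t :=
  not_le.2 (mem_Ioc.1 hk).1

/-! ### Feasible solutions -/

/-- The nested constraints bound the suffix sums from below, as the total is fixed. -/
theorem le_sum_suffix {D : Set ℝ} {v w i : ℕ} (hw : w ≤ P.m) (hi : i ∈ Ico v w) {x : ℕ → ℝ}
    (hx : x ∈ P.nestedFeasible D v w) :
    (P.abar w : ℝ) - P.abar i ≤ ∑ k ∈ Ioc (P.s i) (P.s w), x k := by
  obtain ⟨h1, h2⟩ := mem_Ico.1 hi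
  have h3 := hx.1 i hi
  have h4 := hx.2.1
  rw [block, ← sum_Ioc_consecutive x (s_le_s (by omega) (by omega)) (s_le_s h2.le hw)] at h4
  linarith

/-- Prefix sums satisfying the nested constraints, from lower bounds on the suffix sums. -/
theorem sum_prefix_le {v w i : ℕ} (hw : w ≤ P.m) (hi : i ∈ Ico v w) {x : ℕ → ℝ}
    (hx : ∑ k ∈ P.block v w, x k = (P.abar w : ℝ) - P.abar (v - 1))
    (hs : (P.abar w : ℝ) - P.abar i ≤ ∑ k ∈ Ioc (P.s i) (P.s w), x k) :
    ∑ k ∈ Ioc (P.s (v - 1)) (P.s i), x k ≤ (P.abar i : ℝ) - P.abar (v - 1) := by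
  obtain ⟨h1, h2⟩ := mem_Ico.1 hi
  rw [block, ← sum_Ioc_consecutive x (s_le_s (by omega) (by omega)) (s_le_s h2.le hw)] at hx
  linarith

/-- Concatenating a vector below `xdown` and a vector above `xup`. -/
theorem glue_mem_rapFeasible {D : Set ℝ} {v t w : ℕ} (hvt : v ≤ t) (htw : t ≤ w) (hwm : w ≤ P.m)
    {xdown xup y y' : ℕ → ℝ} (hy : ∀ k ∈ P.block v t, y k ∈ D ∧ 0 ≤ y k ∧ y k ≤ xdown k)
    (hy' : ∀ k ∈ P.block (t + 1) w, y' k ∈ D ∧ xup k ≤ y' k ∧ y' k ≤ P.d k)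
    (hs : ∑ k ∈ P.block v t, y k + ∑ k ∈ P.block (t + 1) w, y' k =
      (P.abar w : ℝ) - P.abar (v - 1)) :
    (fun k => if k ≤ P.s t then y k else y' k) ∈
      P.rapFeasible D v w (P.cHat t xup) (P.dHat t xdown) := by
  refine ⟨?_, fun k hk => ?_⟩
  · rw [← sum_block_add_sum_block hvt htw hwm, ← hs]
    congr 1
    · exact sum_congr rfl fun k hk => if_pos (le_s_of_mem_block hk)
    · exact sum_congr rfl fun k hk => if_neg (not_le_s_of_mem_block hk)
  · rcases mem_block_cases (t := t) hk with ⟨hk, h⟩ | ⟨hk, h⟩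
    · simpa only [cHat, dHat, if_pos h] using hy k hk
    · simpa only [cHat, dHat, if_neg h] using hy' k hk

theorem mem_nestedFeasible_of_mem_rapFeasible {D : Set ℝ} {v t w : ℕ} (hvt : v ≤ t) (htw : t ≤ w)
    (hwm : w ≤ P.m) {xdown xup x : ℕ → ℝ} (hd : xdown ∈ P.nestedFeasible D v t)
    (hu : xup ∈ P.nestedFeasible D (t + 1) w)
    (hx : x ∈ P.rapFeasible D v w (P.cHat t xup) (P.dHat t xdown)) :
    x ∈ P.nestedFeasible D v w := by
  have hleft : ∀ k ∈ P.block v t, 0 ≤ x k ∧ x k ≤ xdown k := fun k hk => by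
    simpa only [cHat, dHat, if_pos (le_s_of_mem_block hk)] using
      (hx.2 k (block_left_subset htw hwm hk)).2
  have hright : ∀ k ∈ P.block (t + 1) w, xup k ≤ x k ∧ x k ≤ P.d k := fun k hk => by
    simpa only [cHat, dHat, if_neg (not_le_s_of_mem_block hk)] using
      (hx.2 k (block_right_subset hvt htw hwm hk)).2
  refine ⟨fun i hi => ?_, hx.1, fun k hk => ⟨(hx.2 k hk).1, ?_⟩⟩
  · obtain ⟨h1, h2⟩ := mem_Ico.1 hi
    rcases lt_trichotomy i t with h | rfl | h
    · refine (sum_le_sum fun k hk => ?_).trans (hd.1 i (mem_Ico.2 ⟨h1, h⟩))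
      exact (hleft k (block_left_subset h.le (htw.trans hwm) hk)).2
    · exact (sum_le_sum fun k hk => (hleft k hk).2).trans hd.2.1.le
    · refine sum_prefix_le hwm hi hx.1 ?_
      refine (le_sum_suffix hwm (mem_Ico.2 ⟨h, h2⟩) hu).trans (sum_le_sum fun k hk => ?_)
      exact (hright k (block_right_subset (v := t + 1) h h2.le hwm hk)).1
  · rcases mem_block_cases (t := t) hk with ⟨hk, -⟩ | ⟨hk, -⟩
    · exact ⟨(hleft k hk).1, (hleft k hk).2.trans (hd.2.2 k hk).2.2⟩
    · exact ⟨(hu.2.2 k hk).2.1.trans (hright k hk).1, (hright k hk).2⟩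

/-! ### Comparison of costs -/

/-- If the change leading from `y` to `z` can be applied to an optimal `x` without losing feasibility,
and `y` lies between `x` and `z`, then `y` costs at most as much as `z`. -/
theorem IsNestedOptimal.cost_le {D : Set ℝ} {v w : ℕ} (hw : w ≤ P.m) {x z y : ℕ → ℝ}
    (hx : P.IsNestedOptimal D v w x)
    (hz : ∀ k ∈ P.block v w, 0 ≤ z k ∧ z k ≤ P.d k)
    (hy : ∀ k ∈ P.block v w, min (x k) (z k) ≤ y k ∧ y k ≤ max (x k) (z k))
    (hf : (fun k => x k + z k - y k) ∈ P.nestedFeasible D v w) :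
    P.cost v w y ≤ P.cost v w z := by
  have h1 := hx.2 _ hf
  have h2 : P.cost v w y + P.cost v w (fun k => x k + z k - y k) ≤
      P.cost v w x + P.cost v w z := by
    simp only [cost, ← sum_add_distrib]
    exact sum_le_sum fun k hk => (convexOn_of_mem_block hw hk).add_le_add_of_min_le_of_le_max
      (hx.1.2.2 k hk).2 (hz k hk) (hy k hk).1 (hy k hk).2
  linarith

/-- On the left range, a vector satisfying the nested constraints, with total at most that of the
optimal `x`, can be moved below `x` without changing its sum or increasing its cost. -/
theorem IsNestedOptimal.exists_le {G : AddSubgroup ℝ} {v t : ℕ} (ht : t ≤ P.m)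
    {x z : ℕ → ℝ} (hx : P.IsNestedOptimal G v t x)
    (hz : ∀ k ∈ P.block v t, z k ∈ G ∧ 0 ≤ z k ∧ z k ≤ P.d k)
    (hzi : ∀ i ∈ Ico v t,
      ∑ k ∈ Ioc (P.s (v - 1)) (P.s i), z k ≤ (P.abar i : ℝ) - P.abar (v - 1))
    (hzt : ∑ k ∈ P.block v t, z k ≤ (P.abar t : ℝ) - P.abar (v - 1)) :
    ∃ y : ℕ → ℝ, (∀ k ∈ P.block v t, y k ∈ G ∧ 0 ≤ y k ∧ y k ≤ x k) ∧
      ∑ k ∈ P.block v t, y k = ∑ k ∈ P.block v t, z k ∧ P.cost v t y ≤ P.cost v t z := by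
  have hxb := hx.1.2.2
  obtain ⟨y, h1, h2, h3⟩ := exists_exchange_le G (fun k => (k : ℤ)) (P.block v t) x z
    (fun k hk => (hxb k hk).1) (fun k hk => (hz k hk).1) (hzt.trans hx.1.2.1.ge)
  refine ⟨y, fun k hk => ⟨(h1 k hk).1, ?_, (h1 k hk).2.2⟩, h2, ?_⟩
  · exact (le_min (hxb k hk).2.1 (hz k hk).2.1).trans (h1 k hk).2.1
  refine hx.cost_le ht (fun k hk => (hz k hk).2)
    (fun k hk => ⟨(h1 k hk).2.1, (h1 k hk).2.2.trans (le_max_left _ _)⟩)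
    ⟨fun i hi => ?_, ?_, fun k hk => ⟨?_, ?_, ?_⟩⟩
  · have hf : (P.block v t).filter (fun k : ℕ => (k : ℤ) ≤ (P.s i : ℤ)) =
        Ioc (P.s (v - 1)) (P.s i) := by
      have := s_le_s (P := P) (mem_Ico.1 hi).2.le ht
      ext k
      simp only [block, mem_filter, mem_Ioc, Nat.cast_le]
      omega
    have := h3 (P.s i)
    rw [hf] at this
    exact this.trans (max_le (hx.1.1 i hi) (hzi i hi))
  · rw [sum_sub_distrib, sum_add_distrib, h2, hx.1.2.1]
    ring
  · exact G.sub_mem (G.add_mem (hxb k hk).1 (hz k hk).1) (h1 k hk).1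
  · linarith [(h1 k hk).2.2, (hz k hk).2.1]
  · linarith [(h1 k hk).2.1, min_add_max (x k) (z k), max_le (hxb k hk).2.2 (hz k hk).2.2]

/-- On the right range, where the constraints on `z` bound its suffix sums from below, `z` can be
moved above the optimal `x` without changing its sum or increasing its cost. -/
theorem IsNestedOptimal.exists_ge {G : AddSubgroup ℝ} {t w : ℕ} (htw : t ≤ w) (hw : w ≤ P.m)
    {x z : ℕ → ℝ} (hx : P.IsNestedOptimal G (t + 1) w x)
    (hz : ∀ k ∈ P.block (t + 1) w, z k ∈ G ∧ 0 ≤ z k ∧ z k ≤ P.d k)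
    (hzi : ∀ i ∈ Ico t w, (P.abar w : ℝ) - P.abar i ≤ ∑ k ∈ Ioc (P.s i) (P.s w), z k) :
    ∃ y : ℕ → ℝ, (∀ k ∈ P.block (t + 1) w, y k ∈ G ∧ x k ≤ y k ∧ y k ≤ P.d k) ∧
      ∑ k ∈ P.block (t + 1) w, y k = ∑ k ∈ P.block (t + 1) w, z k ∧
      P.cost (t + 1) w y ≤ P.cost (t + 1) w z := by
  have hxb := hx.1.2.2
  have hxs : ∑ k ∈ P.block (t + 1) w, x k = (P.abar w : ℝ) - P.abar t := hx.1.2.1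
  have hsum : ∑ k ∈ P.block (t + 1) w, x k ≤ ∑ k ∈ P.block (t + 1) w, z k := by
    rcases htw.lt_or_eq with h | rfl
    · rw [hxs]
      exact hzi t (mem_Ico.2 ⟨le_rfl, h⟩)
    · simp [block]
  -- Reversing the order of the indices makes the suffix sums partial sums of small rank.
  obtain ⟨y, h1, h2, h3⟩ := exists_exchange_ge G (fun k => -(k : ℤ)) (P.block (t + 1) w) x z
    (fun k hk => (hxb k hk).1) (fun k hk => (hz k hk).1) hsum
  have hys : ∑ k ∈ P.block (t + 1) w, (x k + z k - y k) =
      (P.abar w : ℝ) - P.abar (t + 1 - 1) := by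
    rw [sum_sub_distrib, sum_add_distrib, h2, hx.1.2.1]
    ring
  refine ⟨y, fun k hk => ⟨(h1 k hk).1, (h1 k hk).2.1, ?_⟩, h2, ?_⟩
  · exact (h1 k hk).2.2.trans (max_le (hxb k hk).2.2 (hz k hk).2.2)
  refine hx.cost_le hw (fun k hk => (hz k hk).2)
    (fun k hk => ⟨(min_le_left _ _).trans (h1 k hk).2.1, (h1 k hk).2.2⟩)
    ⟨fun i hi => sum_prefix_le hw hi hys ?_, hys, fun k hk => ⟨?_, ?_, ?_⟩⟩
  · obtain ⟨hi1, hi2⟩ := mem_Ico.1 hi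
    have hf : (P.block (t + 1) w).filter (fun k : ℕ => -(k : ℤ) ≤ -(P.s i : ℤ) - 1) =
        Ioc (P.s i) (P.s w) := by
      have : P.s t ≤ P.s i := s_le_s (by omega) (by omega)
      ext k
      simp only [block, mem_filter, mem_Ioc, Nat.add_sub_cancel]
      omega
    have := h3 (-(P.s i : ℤ) - 1)
    rw [hf] at this
    exact (le_min (le_sum_suffix hw hi hx.1) (hzi i (mem_Ico.2 ⟨by omega, hi2⟩))).trans this
  · exact G.sub_mem (G.add_mem (hxb k hk).1 (hz k hk).1) (h1 k hk).1
  · linarith [(h1 k hk).2.2, min_add_max (x k) (z k), le_min (hxb k hk).2.1 (hz k hk).2.1]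
  · linarith [(h1 k hk).2.1, (hz k hk).2.2]

/-- Every feasible solution of the nested problem is matched by one within the tightened bounds. -/
theorem exists_mem_rapFeasible_cost_le {G : AddSubgroup ℝ} {v t w : ℕ} (hvt : v ≤ t)
    (htw : t ≤ w) (hwm : w ≤ P.m) {xdown xup z : ℕ → ℝ} (hd : P.IsNestedOptimal G v t xdown)
    (hu : P.IsNestedOptimal G (t + 1) w xup) (hz : z ∈ P.nestedFeasible G v w) :
    ∃ y ∈ P.rapFeasible G v w (P.cHat t xup) (P.dHat t xdown), P.cost v w y ≤ P.cost v w z := by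
  obtain ⟨y, hy, hys, hyc⟩ := hd.exists_le (htw.trans hwm)
    (fun k hk => hz.2.2 k (block_left_subset htw hwm hk))
    (fun i hi => hz.1 i (Ico_subset_Ico_right htw hi)) (by
      rcases htw.lt_or_eq with h | rfl
      · exact hz.1 t (mem_Ico.2 ⟨hvt, h⟩)
      · exact hz.2.1.le)
  obtain ⟨y', hy', hys', hyc'⟩ := hu.exists_ge htw hwm
    (fun k hk => hz.2.2 k (block_right_subset hvt htw hwm hk))
    (fun i hi => le_sum_suffix hwm (Ico_subset_Ico_left hvt hi) hz)
  refine ⟨_, glue_mem_rapFeasible hvt htw hwm hy hy' ?_, ?_⟩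
  · rw [hys, hys', sum_block_add_sum_block hvt htw hwm, hz.2.1]
  · unfold cost at hyc hyc' ⊢
    rw [← sum_block_add_sum_block hvt htw hwm, ← sum_block_add_sum_block hvt htw hwm]
    refine add_le_add (le_trans (sum_congr rfl fun k hk => ?_).le hyc)
      (le_trans (sum_congr rfl fun k hk => ?_).le hyc')
    · simp only [if_pos (le_s_of_mem_block hk)]
    · simp only [if_neg (not_le_s_of_mem_block hk)]

theorem IsRapOptimal.isNestedOptimal {G : AddSubgroup ℝ} {v t w : ℕ} (hvt : v ≤ t)
    (htw : t ≤ w) (hwm : w ≤ P.m) {xdown xup x : ℕ → ℝ} (hd : P.IsNestedOptimal G v t xdown)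
    (hu : P.IsNestedOptimal G (t + 1) w xup)
    (hx : P.IsRapOptimal G v w (P.cHat t xup) (P.dHat t xdown) x) :
    P.IsNestedOptimal G v w x := by
  refine ⟨mem_nestedFeasible_of_mem_rapFeasible hvt htw hwm hd.1 hu.1 hx.1, fun z hz => ?_⟩
  obtain ⟨y, hy, hyz⟩ := exists_mem_rapFeasible_cost_le hvt htw hwm hd hu hz
  exact (hx.2 y hy).trans hyz

/-! ### Existence of optimal solutions -/

/-- A feasible resource allocation problem with closed variable domain and lower semicontinuous
costs has an optimal solution. -/
theorem exists_isRapOptimal {D : Set ℝ} (hD : IsClosed D) {v w : ℕ} {c u : ℕ → ℝ}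
    (hlsc : ∀ k ∈ P.block v w, LowerSemicontinuousOn (P.f k) (Set.Icc (c k) (u k) ∩ D))
    (hne : (P.rapFeasible D v w c u).Nonempty) : ∃ x, P.IsRapOptimal D v w c u x := by
  classical
  -- The coordinates outside the block are fixed to `0` to make the feasible set compact.
  set box : Set (ℕ → ℝ) := Set.univ.pi fun k =>
    if k ∈ P.block v w then Set.Icc (c k) (u k) ∩ D else {0}
  set K : Set (ℕ → ℝ) :=
    box ∩ {x | ∑ k ∈ P.block v w, x k = (P.abar w : ℝ) - P.abar (v - 1)}
  have hbc : IsCompact box := by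
    refine isCompact_univ_pi fun k => ?_
    split_ifs
    · exact isCompact_Icc.inter_right hD
    · exact isCompact_singleton
  have hKc : IsCompact K := hbc.inter_right (isClosed_eq (by fun_prop) continuous_const)
  have hKb : ∀ x ∈ K, ∀ k ∈ P.block v w, x k ∈ Set.Icc (c k) (u k) ∩ D := fun x hx k hk => by
    have := hx.1 k (Set.mem_univ k)
    simpa only [if_pos hk] using this
  have hl : LowerSemicontinuousOn (P.cost v w) K :=
    lowerSemicontinuousOn_sum fun k hk =>
      (hlsc k hk).comp (g := fun x : ℕ → ℝ => x k) (continuous_apply k).continuousOn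
        fun x hx => hKb x hx k hk
  have htrunc : ∀ z ∈ P.rapFeasible D v w c u, ∃ y ∈ K, P.cost v w y = P.cost v w z := by
    intro z hz
    refine ⟨fun k => if k ∈ P.block v w then z k else 0, ⟨fun k _ => ?_, ?_⟩,
      sum_congr rfl fun k hk => by simp only [if_pos hk]⟩
    · by_cases hk : k ∈ P.block v w
      · simp only [if_pos hk]
        exact ⟨(hz.2 k hk).2, (hz.2 k hk).1⟩
      · simp only [if_neg hk, Set.mem_singleton_iff]
    · exact (sum_congr rfl fun k hk => if_pos hk).trans hz.1
  obtain ⟨z, hz⟩ := hne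
  obtain ⟨y, hy, -⟩ := htrunc z hz
  obtain ⟨x, hx, hmin⟩ := LowerSemicontinuousOn.exists_isMinOn ⟨y, hy⟩ hKc hl
  refine ⟨x, ⟨hx.2, fun k hk => ⟨(hKb x hx k hk).2, (hKb x hx k hk).1⟩⟩, fun z hz => ?_⟩
  obtain ⟨y, hy, hyz⟩ := htrunc z hz
  rw [← hyz]
  exact isMinOn_iff.1 hmin y hy

theorem rapFeasible_nonempty {D : Set ℝ} {v t w : ℕ} (hvt : v ≤ t) (htw : t ≤ w) (hwm : w ≤ P.m)
    {xdown xup : ℕ → ℝ} (hd : xdown ∈ P.nestedFeasible D v t)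
    (hu : xup ∈ P.nestedFeasible D (t + 1) w) :
    (P.rapFeasible D v w (P.cHat t xup) (P.dHat t xdown)).Nonempty := by
  refine ⟨_, glue_mem_rapFeasible hvt htw hwm (y := xdown) (y' := xup)
    (fun k hk => ⟨(hd.2.2 k hk).1, (hd.2.2 k hk).2.1, le_rfl⟩)
    (fun k hk => ⟨(hu.2.2 k hk).1, le_rfl, (hu.2.2 k hk).2.2⟩) ?_⟩
  rw [hd.2.1, hu.2.1, Nat.add_sub_cancel]
  ring

theorem Icc_cHat_dHat_subset {D : Set ℝ} {v t w k : ℕ} {xdown xup : ℕ → ℝ}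
    (hd : xdown ∈ P.nestedFeasible D v t) (hu : xup ∈ P.nestedFeasible D (t + 1) w)
    (hk : k ∈ P.block v w) :
    Set.Icc (P.cHat t xup k) (P.dHat t xdown k) ⊆ Set.Icc 0 (P.d k : ℝ) := by
  rcases mem_block_cases (t := t) hk with ⟨hk, h⟩ | ⟨hk, h⟩
  · simp only [cHat, dHat, if_pos h]
    exact Set.Icc_subset_Icc le_rfl (hd.2.2 k hk).2.2
  · simp only [cHat, dHat, if_neg h]
    exact Set.Icc_subset_Icc (hu.2.2 k hk).2.1 le_rfl

end NestedProblem

theorem finite_Icc_inter_range_intCast (a b : ℝ) :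
    (Set.Icc a b ∩ Set.range ((↑) : ℤ → ℝ)).Finite := by
  rw [← Set.image_preimage_eq_inter_range, Int.preimage_Icc]
  exact (Set.finite_Icc _ _).image _

theorem corollary1 (P : NestedProblem) (v t w : ℕ)
    (hv : 1 ≤ v) (hvt : v ≤ t) (htw : t ≤ w) (hwm : w ≤ P.m) (hvw : v < w) :
    -- integer variables
    (∀ xdown xup : ℕ → ℝ,
      P.IsNestedOptimal (Set.range ((↑) : ℤ → ℝ)) v t xdown →
      P.IsNestedOptimal (Set.range ((↑) : ℤ → ℝ)) (t + 1) w xup →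
        (∃ x, P.IsRapOptimal (Set.range ((↑) : ℤ → ℝ)) v w (P.cHat t xup) (P.dHat t xdown) x) ∧
        (∀ x, P.IsRapOptimal (Set.range ((↑) : ℤ → ℝ)) v w (P.cHat t xup) (P.dHat t xdown) x →
          P.IsNestedOptimal (Set.range ((↑) : ℤ → ℝ)) v w x)) ∧
    -- continuous variables; lower semicontinuity is used for the existence of an optimum only
    (∀ xdown xup : ℕ → ℝ,
      P.IsNestedOptimal Set.univ v t xdown →
      P.IsNestedOptimal Set.univ (t + 1) w xup →
        ((∀ i ∈ P.block v w, LowerSemicontinuousOn (P.f i) (Set.Icc 0 (P.d i : ℝ))) →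
          ∃ x, P.IsRapOptimal Set.univ v w (P.cHat t xup) (P.dHat t xdown) x) ∧
        (∀ x, P.IsRapOptimal Set.univ v w (P.cHat t xup) (P.dHat t xdown) x →
          P.IsNestedOptimal Set.univ v w x)) := by
  refine ⟨fun xdown xup hd hu => ⟨?_, fun x hx => ?_⟩,
    fun xdown xup hd hu => ⟨fun hf => ?_, fun x hx => ?_⟩⟩
  · -- Any function is continuous on the finite set of integers between two bounds.
    exact NestedProblem.exists_isRapOptimal Int.isClosedEmbedding_coe_real.isClosed_range
      (fun k _ => ((finite_Icc_inter_range_intCast _ _).continuousOn _).lowerSemicontinuousOn)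
      (NestedProblem.rapFeasible_nonempty hvt htw hwm hd.1 hu.1)
  · exact NestedProblem.IsRapOptimal.isNestedOptimal (G := (Int.castAddHom ℝ).range)
      hvt htw hwm hd hu hx
  · exact NestedProblem.exists_isRapOptimal isClosed_univ
      (fun k hk => (hf k hk).mono (Set.inter_subset_left.trans
        (NestedProblem.Icc_cHat_dHat_subset hd.1 hu.1 hk)))
      (NestedProblem.rapFeasible_nonempty hvt htw hwm hd.1 hu.1)
  · exact NestedProblem.IsRapOptimal.isNestedOptimal (G := ⊤) hvt htw hwm hd hu hx
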